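/- Setup. Let $G$ be a finite connected graph, $x$ a vertex of $G$ whose eccentricity equals $\operatorname{diam}(G)=D$, and fix a proper $k$-coloring of $G$. Let the layer $L_i$ be the set of vertices at distance $i$ from $x$; a clump in $L_i$ is a nonempty set consisting of all vertices of $L_i$ of one given color. The weighted clump graph $H$ of $G$ (with respect to $x$ and the coloring) has the clumps as vertices, two clumps being adjacent if $G$ has an edge between them; each clump is weighted by its number of vertices and inherits its layer and its color. Let $c(i)$ be the number of clumps (i.e. of colors) in $L_i$. Then $H$ has layers $L_0,\dots,L_D$ with $D=\operatorname{diam}(H)$, and $H$ is called canonical if for every $1\le i<D$: (i) if $c(i)=1$, then $c(i+1)\le k-1$; (ii) exactly $\min(k,c(i)+c(i+1))$ colors are used on $L_i\cup L_{i+1}$; (iii) if $c(i)=k$, then $i\ge 2$ and $c(i+1)\ge 2$; (iv) if some clump in $L_i$ has weight greater than $1$, then $c(i)+\max(c(i-1),c(i+1))\ge k$. For a connected $k$-colorable graph $G$ of minimum degree at least $\delta$, a canonical clump graph of $G$ is a canonical weighted clump graph of some $k$-colored connected graph $G'$ (possibly $G'=G$) with the same order and diameter as $G$ and with minimum degree at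 least $\delta$. Theorem. There is an absolute constant $K$ such that the following holds. Let $\delta\ge 1$ and let $G$ be a connected $3$-colorable graph of order $n$ and minimum degree at least $\delta$. If $G$ has a canonical clump graph (with $k=3$) in which no layer $L_i$ with $0<i<\operatorname{diam}(G)$ is a single, i.e. $c(i)\ne 1$ for all $0<i<\operatorname{diam}(G)$, then $$\operatorname{diam}(G)\le \frac{7n}{3\delta}+K.$$ -/

import Mathlib

/-- A layered, properly `k`-coloured graph with positive integer weights on its vertices, having at
most one vertex of each colour in each layer.  The vertex of colour `c` in layer `i` is the pair
`(i, c)`; `verts` is the set of the pairs that occur. -/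
structure WeightedClumpGraph (k : ℕ) where
  verts : Finset (ℕ × Fin k)
  graph : SimpleGraph {p : ℕ × Fin k // p ∈ verts}
  weight : {p : ℕ × Fin k // p ∈ verts} → ℕ
  weight_pos : ∀ p, 1 ≤ weight p
  proper : ∀ p q, graph.Adj p q → p.1.2 ≠ q.1.2
  layered : ∀ p q, graph.Adj p q → p.1.1 ≤ q.1.1 + 1

namespace WeightedClumpGraph

variable {k : ℕ}

/-- The set of colours used in layer `L_i`. -/
def colors (H : WeightedClumpGraph k) (i : ℕ) : Finset (Fin k) :=
  Finset.univ.filter fun c => (i, c) ∈ H.verts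

/-- `c(i) = |L_i|`: the number of vertices of the clump graph (equivalently, of colours) in layer
`L_i`. -/
def c (H : WeightedClumpGraph k) (i : ℕ) : ℕ := (H.colors i).card

/-- The defining properties of a canonical clump graph, with `D = diam H`: the layers of `H` are
exactly `L_0, …, L_D`, and the four conditions hold for all `1 ≤ i < D`. -/
structure IsCanonical (H : WeightedClumpGraph k) : Prop where
  layers : ∀ i, (H.colors i).Nonempty ↔ i ≤ H.graph.diam
  single : ∀ i, 1 ≤ i → i < H.graph.diam → H.c i = 1 → H.c (i + 1) + 1 ≤ k
  manyColors : ∀ i, 1 ≤ i → i < H.graph.diam →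
    (H.colors i ∪ H.colors (i + 1)).card = min k (H.c i + H.c (i + 1))
  full : ∀ i, 1 ≤ i → i < H.graph.diam → H.c i = k → 2 ≤ i ∧ 2 ≤ H.c (i + 1)
  heavy : ∀ i, 1 ≤ i → i < H.graph.diam → (∃ p, p.1.1 = i ∧ 1 < H.weight p) →
    0 < i ∧ k ≤ H.c i + max (H.c (i - 1)) (H.c (i + 1))

end WeightedClumpGraph

section ClumpGraph

variable {V : Type*} [Fintype V] {k : ℕ}

open Classical in
/-- The clump of colour `p.2` in the `p.1`-st distance layer from `x`. -/
noncomputable def clump (G : SimpleGraph V) (x : V) (col : G.Coloring (Fin k)) (p : ℕ × Fin k) :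
    Finset V :=
  Finset.univ.filter fun v => G.dist x v = p.1 ∧ col v = p.2

/-- The weighted clump graph of `G` for the distance layering from `x` and the proper colouring
`col`: its vertices are the nonempty clumps, two of them are adjacent when `G` has an edge between
the two clumps, and the weight of a clump is its number of vertices. -/
noncomputable def clumpGraph (G : SimpleGraph V) (x : V) (col : G.Coloring (Fin k)) :
    WeightedClumpGraph k where
  verts := Finset.univ.image fun v => (G.dist x v, col v)
  graph :=
    { Adj := fun p q => ∃ u ∈ clump G x col p.1, ∃ v ∈ clump G x col q.1, G.Adj u v
      symm := ⟨fun _ _ ⟨u, hu, v, hv, h⟩ => ⟨v, hv, u, hu, h.symm⟩⟩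
      loopless := ⟨by
        rintro p ⟨u, hu, v, hv, h⟩
        simp only [clump, Finset.mem_filter] at hu hv
        exact col.valid h (hu.2.2.trans hv.2.2.symm)⟩ }
  weight := fun p => (clump G x col p.1).card
  weight_pos := by
    rintro ⟨p, hp⟩
    obtain ⟨v, -, rfl⟩ := Finset.mem_image.1 hp
    exact Finset.card_pos.2 ⟨v, by simp [clump]⟩
  proper := by
    rintro p q ⟨u, hu, v, hv, h⟩ e
    simp only [clump, Finset.mem_filter] at hu hv
    exact col.valid h (hu.2.2.trans (e.trans hv.2.2.symm))
  layered := by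
    rintro p q ⟨u, hu, v, hv, h⟩
    simp only [clump, Finset.mem_filter] at hu hv
    rw [← hu.2.1, ← hv.2.1]
    have := h.diff_dist_adj (u := x)
    omega

open Classical in
/-- `H` is a canonical clump graph of the graph `G`, regarded as a graph of minimum degree at least
`δ`: `H` is canonical, and it is the clump graph of a properly `k`-coloured connected graph `G'`
with the same order, the same diameter and minimum degree at least `δ`, layered from a vertex `x`
whose eccentricity is the diameter.  (`G' = G` is allowed; in general `G` is replaced by such a
`G'`, which may be taken on the same vertex set because the orders agree.) -/
def IsCanonicalClumpGraphOf (H : WeightedClumpGraph k) (G : SimpleGraph V) (δ : ℕ) : Prop :=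
  ∃ (G' : SimpleGraph V) (x : V) (col : G'.Coloring (Fin k)),
    G'.Connected ∧ G'.diam = G.diam ∧ δ ≤ G'.minDegree ∧ G'.eccent x = G'.ediam ∧
      H = clumpGraph G' x col ∧ H.IsCanonical

end ClumpGraph

/-!
The bound is linear programming duality. Write `A i` for the set of colours of the layer `L_i`.
Each clump of colour `c` in the layer `L_i` gets the dual weight `1` if `c ∈ A (i - 1)` and `2` if
`c ∉ A (i - 1)` (`dualWeight`). As no inner layer is a single, any two consecutive inner layers
together use all three colours, so the weights in the layer `L_i` sum to
`|A i| + 3 - |A (i - 1)|` (`sum_dualWeight_add_card`), and the sum over all layers telescopes to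
`3 * diam - O(1)` (`sum_range_dualWeight`).

On the other hand, a vertex in the layer `L_j` is adjacent only to vertices in the layers `L_{j-1}`,
`L_j`, `L_{j+1}` of the two other colours. No colour misses two consecutive layers, so in such a
window a colour carries weight at most `3`, or `4` if it is missing from `L_{j-2}`. At most one
colour is missing there, so the two colours together carry at most `7`
(`sum_dualWeight_window_le`). Choosing a vertex in every clump and counting the edges at the chosen
vertices with the dual weights gives `δ * (3 * diam - O(1)) ≤ 7 * n`
(`minDegree_mul_sum_dualWeight_le`).
-/

/-- The dual weight of the clump of colour `c` in a layer with colour set `Q` that follows a layer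
with colour set `P`. It is `0` when there is no such clump. -/
def dualWeight (P Q : Finset (Fin 3)) (c : Fin 3) : ℕ :=
  if c ∈ Q then if c ∈ P then 1 else 2 else 0

/-- The weight of a layer, in a form whose sum over consecutive layers telescopes. -/
theorem sum_dualWeight_add_card :
    ∀ P Q : Finset (Fin 3), P ∪ Q = Finset.univ →
      ∑ c, dualWeight P Q c + P.card = Q.card + 3 := by
  decide

theorem sum_range_dualWeight (B : ℕ → Finset (Fin 3))
    (hB : ∀ i, B i ∪ B (i + 1) = Finset.univ) (m : ℕ) :
    ∑ i ∈ Finset.range m, ∑ c, dualWeight (B i) (B (i + 1)) c + (B 0).card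
      = 3 * m + (B m).card := by
  induction m with
  | zero => simp
  | succ m ih =>
    have := sum_dualWeight_add_card _ _ (hB m)
    rw [Finset.sum_range_succ]
    omega

/-- The weight of one colour on three consecutive layers, which have the colour sets `Q`, `R`, `S`
and follow a layer with colour set `P`. -/
theorem dualWeight_window_le {P Q R S : Finset (Fin 3)} (hPQ : P ∪ Q = Finset.univ)
    (hQR : Q ∪ R = Finset.univ) (hRS : R ∪ S = Finset.univ) (c : Fin 3) :
    dualWeight P Q c + dualWeight Q R c + dualWeight R S c ≤ 3 + if c ∈ P then 0 else 1 := by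
  have h₁ : c ∈ P ∨ c ∈ Q := by simpa [hPQ] using (Finset.mem_union (s := P) (t := Q) (a := c))
  have h₂ : c ∈ Q ∨ c ∈ R := by simpa [hQR] using (Finset.mem_union (s := Q) (t := R) (a := c))
  have h₃ : c ∈ R ∨ c ∈ S := by simpa [hRS] using (Finset.mem_union (s := R) (t := S) (a := c))
  unfold dualWeight
  split_ifs <;> omega

/-- Dual feasibility: two colours carry a dual weight of at most `7` on three consecutive layers. -/
theorem sum_dualWeight_window_le {P Q R S : Finset (Fin 3)} (hP : 2 ≤ P.card)
    (hPQ : P ∪ Q = Finset.univ) (hQR : Q ∪ R = Finset.univ) (hRS : R ∪ S = Finset.univ)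
    (c₀ : Fin 3) :
    ∑ c ∈ Finset.univ.erase c₀, (dualWeight P Q c + dualWeight Q R c + dualWeight R S c) ≤ 7 := by
  have two_colors : ∀ P : Finset (Fin 3), 2 ≤ P.card → ∀ c₀,
      ∑ c ∈ Finset.univ.erase c₀, (3 + if c ∈ P then 0 else 1) ≤ 7 := by decide
  exact (Finset.sum_le_sum fun c _ => dualWeight_window_le hPQ hQR hRS c).trans (two_colors P hP c₀)

section Counting

variable {V : Type*} [Fintype V]

open Classical in
/-- Double counting: `B` is a sequence of colour sets which, in the layers `2 ≤ i < D`, are colours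
that actually occur. The layers outside this range only pad the sequence. -/
theorem minDegree_mul_sum_dualWeight_le {G : SimpleGraph V} {x : V} (col : G.Coloring (Fin 3))
    {δ D : ℕ} (hδ : δ ≤ G.minDegree) (B : ℕ → Finset (Fin 3)) (hB2 : ∀ i, 2 ≤ (B i).card)
    (hBu : ∀ i, B i ∪ B (i + 1) = Finset.univ) (hB0 : B 0 = Finset.univ)
    (hB : ∀ i, 2 ≤ i → i < D → ∀ c ∈ B i, ∃ v, G.dist x v = i ∧ col v = c) :
    δ * ∑ i ∈ Finset.Ico 2 D, ∑ c, dualWeight (B (i - 1)) (B i) c ≤ 7 * Fintype.card V := by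
  -- `near p u` holds whenever `u` has a neighbour in the clump `p`.
  let near : ℕ × Fin 3 → V → Prop := fun p u =>
    p.1 ≤ G.dist x u + 1 ∧ G.dist x u ≤ p.1 + 1 ∧ p.2 ≠ col u
  let y : ℕ × Fin 3 → ℕ := fun p => dualWeight (B (p.1 - 1)) (B p.1) p.2
  have key : ∀ p ∈ Finset.Ico 2 D ×ˢ (Finset.univ : Finset (Fin 3)),
      δ * y p ≤ ∑ u, if near p u then y p else 0 := by
    rintro ⟨i, c⟩ hp
    simp only [Finset.mem_product, Finset.mem_Ico, Finset.mem_univ, and_true] at hp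
    by_cases hc : c ∈ B i
    · obtain ⟨v, rfl, rfl⟩ := hB i hp.1 hp.2 c hc
      rw [← Finset.sum_filter, Finset.sum_const, smul_eq_mul]
      refine Nat.mul_le_mul_right _ ((hδ.trans (G.minDegree_le_degree v)).trans ?_)
      refine Finset.card_le_card fun u hu => ?_
      rw [SimpleGraph.mem_neighborFinset] at hu
      have h₁ := hu.diff_dist_adj (u := x)
      have h₂ := col.valid hu
      simp only [Finset.mem_filter, Finset.mem_univ, true_and, near]
      exact ⟨by omega, by omega, h₂⟩
    · simp [y, dualWeight, hc]
  have feasible : ∀ u, ∑ p ∈ Finset.Ico 2 D ×ˢ (Finset.univ : Finset (Fin 3)),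
      (if near p u then y p else 0) ≤ 7 := by
    intro u
    rw [← Finset.sum_filter]
    obtain hj | ⟨j, hj⟩ : G.dist x u = 0 ∨ ∃ j, G.dist x u = j + 1 :=
      (Nat.eq_zero_or_eq_succ_pred _).imp id fun h => ⟨_, h⟩
    · rw [Finset.sum_eq_zero]
      · omega
      · rintro ⟨i, c⟩ hp
        simp only [Finset.mem_filter, Finset.mem_product, Finset.mem_Ico, near] at hp
        omega
    · have hsub : (Finset.Ico 2 D ×ˢ (Finset.univ : Finset (Fin 3))).filter (near · u) ⊆
          Finset.Ico j (j + 3) ×ˢ Finset.univ.erase (col u) := by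
        rintro ⟨i, c⟩ hp
        simp only [Finset.mem_filter, Finset.mem_product, Finset.mem_Ico, near,
          Finset.mem_erase, Finset.mem_univ, and_true] at hp ⊢
        exact ⟨by omega, hp.2.2.2⟩
      refine (Finset.sum_le_sum_of_subset hsub).trans ?_
      -- For `j = 0` the truncated `j - 1` is harmless, as `B 0` is the full colour set.
      have hu : B (j - 1) ∪ B j = Finset.univ := by
        cases j with
        | zero => simp [hB0]
        | succ j => exact hBu j
      rw [Finset.sum_product_right]
      refine le_trans (le_of_eq ?_)
        (sum_dualWeight_window_le (hB2 (j - 1)) hu (hBu j) (hBu (j + 1)) (col u))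
      refine Finset.sum_congr rfl fun c _ => ?_
      rw [Finset.sum_Ico_eq_sum_range]
      simp [Finset.sum_range_succ, y, add_assoc]
  calc δ * ∑ i ∈ Finset.Ico 2 D, ∑ c, dualWeight (B (i - 1)) (B i) c
      = ∑ p ∈ Finset.Ico 2 D ×ˢ (Finset.univ : Finset (Fin 3)), δ * y p := by
        rw [← Finset.mul_sum, Finset.sum_product]
    _ ≤ ∑ p ∈ Finset.Ico 2 D ×ˢ (Finset.univ : Finset (Fin 3)),
          ∑ u, if near p u then y p else 0 := Finset.sum_le_sum key
    _ = ∑ u, ∑ p ∈ Finset.Ico 2 D ×ˢ (Finset.univ : Finset (Fin 3)),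
          if near p u then y p else 0 := Finset.sum_comm
    _ ≤ ∑ _u : V, 7 := Finset.sum_le_sum fun u _ => feasible u
    _ = 7 * Fintype.card V := by simp [mul_comm]

theorem mem_colors_clumpGraph {k : ℕ} {G : SimpleGraph V} {x : V} {col : G.Coloring (Fin k)}
    {i : ℕ} {c : Fin k} :
    c ∈ (clumpGraph G x col).colors i ↔ ∃ v, G.dist x v = i ∧ col v = c := by
  simp [WeightedClumpGraph.colors, clumpGraph]

/-- For a layering from a vertex of maximal eccentricity, a canonical clump graph has at least the
diameter of the graph. -/
theorem diam_le_diam_clumpGraph {k : ℕ} {G : SimpleGraph V} {x : V} {col : G.Coloring (Fin k)}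
    (hx : G.eccent x = G.ediam) (hH : (clumpGraph G x col).IsCanonical) :
    G.diam ≤ (clumpGraph G x col).graph.diam := by
  have : Nonempty V := ⟨x⟩
  obtain ⟨v, hv⟩ := SimpleGraph.exists_edist_eq_eccent_of_finite (G := G) x
  have hd : G.dist x v = G.diam := by
    rw [SimpleGraph.dist, SimpleGraph.diam, hv, hx]
  exact (hH.layers _).1 ⟨col v, mem_colors_clumpGraph.2 ⟨v, hd, rfl⟩⟩

end Counting

theorem mainTheorem6 :
    ∃ K : ℝ, ∀ (V : Type*) [Fintype V] (G : SimpleGraph V) [DecidableRel G.Adj] (δ : ℕ),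
      1 ≤ δ → G.Connected → G.Colorable 3 → δ ≤ G.minDegree →
      ∀ H : WeightedClumpGraph 3, IsCanonicalClumpGraphOf H G δ →
        (∀ i : ℕ, 0 < i → i < G.diam → H.c i ≠ 1) →
        (G.diam : ℝ) ≤ 7 * (Fintype.card V : ℝ) / (3 * (δ : ℝ)) + K := by
  refine ⟨3, ?_⟩
  intro V _ G _ δ hδ _ _ _ H hH hsingle
  obtain ⟨G', x, col, -, hdiam, hmin, hecc, rfl, hcan⟩ := hH
  set H := clumpGraph G' x col with hHdef
  have hD : G.diam ≤ H.graph.diam := hdiam ▸ diam_le_diam_clumpGraph hecc hcan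
  set D := G.diam with hDdef
  have hc2 : ∀ i, 1 ≤ i → i < D → 2 ≤ (H.colors i).card := by
    intro i h₁ h₂
    have h₃ := ((hcan.layers i).2 (by omega)).card_pos
    have h₄ : (H.colors i).card ≠ 1 := hsingle i h₁ h₂
    omega
  -- Outside the inner layers, the sequence of colour sets is padded by the full colour set.
  let B : ℕ → Finset (Fin 3) := fun i => if 1 ≤ i ∧ i < D then H.colors i else Finset.univ
  have hB2 : ∀ i, 2 ≤ (B i).card := by
    intro i
    by_cases h : 1 ≤ i ∧ i < D
    · simpa [B, h] using hc2 i h.1 h.2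
    · simp [B, h]
  have hBu : ∀ i, B i ∪ B (i + 1) = Finset.univ := by
    intro i
    by_cases h : 1 ≤ i ∧ i < D
    · by_cases h' : i + 1 < D
      · have h₁ := hcan.manyColors i h.1 (by omega)
        have h₂ := hc2 i h.1 h.2
        have h₃ := hc2 (i + 1) (by omega) h'
        rw [← Finset.card_eq_iff_eq_univ, Fintype.card_fin]
        simp only [WeightedClumpGraph.c] at h₁
        simp only [B, h, h', and_self, if_true, show 1 ≤ i + 1 by omega]
        omega
      · simp [B, h']
    · simp [B, h]
  have hcount := minDegree_mul_sum_dualWeight_le (x := x) (D := D) col hmin B hB2 hBu (by simp [B])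
    (by
      intro i h₁ h₂ c hc
      have hi : 1 ≤ i ∧ i < D := ⟨by omega, h₂⟩
      simp only [B, hi, and_self, if_true] at hc
      exact mem_colors_clumpGraph.1 hc)
  have hsum := sum_range_dualWeight (fun i => B (i + 1)) (fun i => hBu (i + 1)) (D - 2)
  have hcard : (B 1).card ≤ 3 := by simpa using Finset.card_le_univ (B 1)
  have hcard' := hB2 (D - 2 + 1)
  rw [Finset.sum_Ico_eq_sum_range] at hcount
  have hidx : ∀ i, B (2 + i - 1) = B (i + 1) ∧ B (2 + i) = B (i + 1 + 1) := fun i =>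
    ⟨congrArg B (by omega), congrArg B (by omega)⟩
  simp only [hidx] at hcount
  simp only [zero_add] at hsum
  have hlow : 3 * D ≤ ∑ i ∈ Finset.range (D - 2), ∑ c, dualWeight (B (i + 1)) (B (i + 1 + 1)) c + 7 :=
    by omega
  have hfin : δ * (3 * D) ≤ 7 * Fintype.card V + δ * 7 :=
    (Nat.mul_le_mul_left δ hlow).trans (by rw [mul_add]; omega)
  have hfin' : (δ : ℝ) * (3 * D) ≤ 7 * Fintype.card V + δ * 7 := by exact_mod_cast hfin
  have hδ' : (1 : ℝ) ≤ δ := by exact_mod_cast hδ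
  rw [← sub_le_iff_le_add, le_div_iff₀ (by positivity)]
  nlinarith
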